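/- For $E\subset\{1,2,\dots\}$ let $$\underline d(E)=\liminf_{n\to\infty}\frac{\#(E\cap[1,n])}{n},\qquad \underline d_{\log}(E)=\liminf_{n\to\infty}\frac{\sum_{k\in E,\,k\le n}1/k}{\sum_{k=1}^n 1/k}.$$ A continuous linear operator $T$ on a topological vector space $X$ is called frequently hypercyclic (respectively logarithmically-frequently hypercyclic) if there is $x\in X$ such that for every non-empty open set $U\subset X$ the set $\{n\ge 1: T^nx\in U\}$ has positive lower density $\underline d$ (respectively positive lower logarithmic density $\underline d_{\log}$). **Theorem.** There is an operator that is logarithmically-frequently hypercyclic but not frequently hypercyclic. More precisely, let $c_0$ be the Banach space of real or of complex null sequences $(x_n)_{n\ge0}$. Then there are $a>1$ and $\varepsilon>0$ with $a^2(1-4\varepsilon)>1+4\varepsilon$, a strictly increasing sequence of integers $(b_p)$ with $b_p\ge(8p+1)2^p$ for $p\ge1$, and a weight sequence $(w_n)_{n\ge1}$ with $\frac12\le w_n\le 2$ for all $n\geq 1$, with the following properties. Put $I_u^{\delta}=[2^{(1-\delta)a^{2u}},2^{(1+\delta)a^{2u}}]$. 1. $w_1\cdots w_n\ge 2^u$ for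 every integer $n\in I_u^{\varepsilon}$, $u\ge2$; $w_1\cdots w_n\ge 2^p$ whenever $p\ge1$ and $|n-mb_p|\le 2p$ for some integer $m\ge1$; and $w_1\cdots w_n=1$ for every $n\ge 0$ that lies in none of the intervals $I_u^{4\varepsilon}$, $u\ge2$, and satisfies $|n-mb_p|>4p$ for all $m,p\ge1$. 2. The weighted backward shift $B_w(x_0,x_1,x_2,\dots)=(w_1x_1,w_2x_2,w_3x_3,\dots)$ is a bounded operator on $c_0$ with a bounded right inverse; it is logarithmically-frequently hypercyclic but not frequently hypercyclic. -/

import Mathlib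

open Filter
open scoped ZeroAtInfty

noncomputable section

/-- The lower weighted density of `E ⊆ {1, 2, …}` for the weights `α 1, α 2, …`:
`liminf_n (∑_{k ≤ n, k ∈ E} α k) / (∑_{k ≤ n} α k)`. -/
def lowerWeightedDensity (α : ℕ → ℝ) (E : Set ℕ) : ℝ :=
  liminf (fun n : ℕ =>
    (∑ k ∈ Finset.Icc 1 n, E.indicator α k) / (∑ k ∈ Finset.Icc 1 n, α k)) atTop

/-- The lower natural density. -/
def lowerNaturalDensity (E : Set ℕ) : ℝ :=
  lowerWeightedDensity (fun _ => 1) E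

/-- The lower logarithmic density. -/
def lowerLogDensity (E : Set ℕ) : ℝ :=
  lowerWeightedDensity (fun k => (k : ℝ)⁻¹) E

/-- The return set `{n ≥ 1 : T^n x ∈ U}`. -/
def returnSet {𝕜 X : Type*} [NormedField 𝕜] [AddCommGroup X] [Module 𝕜 X]
    [TopologicalSpace X] (T : X →L[𝕜] X) (x : X) (U : Set X) : Set ℕ :=
  {n : ℕ | 1 ≤ n ∧ (T ^ n) x ∈ U}

/-- Frequent hypercyclicity. -/
def FrequentlyHypercyclic {𝕜 X : Type*} [NormedField 𝕜] [AddCommGroup X] [Module 𝕜 X]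
    [TopologicalSpace X] (T : X →L[𝕜] X) : Prop :=
  ∃ x : X, ∀ U : Set X, IsOpen U → U.Nonempty → 0 < lowerNaturalDensity (returnSet T x U)

/-- Logarithmically-frequent hypercyclicity. -/
def LogFrequentlyHypercyclic {𝕜 X : Type*} [NormedField 𝕜] [AddCommGroup X] [Module 𝕜 X]
    [TopologicalSpace X] (T : X →L[𝕜] X) : Prop :=
  ∃ x : X, ∀ U : Set X, IsOpen U → U.Nonempty → 0 < lowerLogDensity (returnSet T x U)

/-- `B` is the weighted backward shift `B_w` on `c₀` (sequences indexed by `0, 1, 2, …`):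
`B_w e_0 = 0` and `B_w e_n = w_n e_{n-1}` for `n ≥ 1`, that is `(B_w x)_n = w_{n+1} x_{n+1}`.
The value `w 0` plays no role. -/
def IsWeightedBackwardShift {𝕜 : Type*} [RCLike 𝕜] (w : ℕ → ℝ)
    (B : C₀(ℕ, 𝕜) →L[𝕜] C₀(ℕ, 𝕜)) : Prop :=
  ∀ (x : C₀(ℕ, 𝕜)) (n : ℕ), B x n = (w (n + 1) : 𝕜) * x (n + 1)

/-- The interval `I_u^{a,ε} = [2^{(1-ε)a^{2u}}, 2^{(1+ε)a^{2u}}]`. -/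
def lacunaryInterval (a ε : ℝ) (u : ℕ) : Set ℝ :=
  Set.Icc ((2 : ℝ) ^ ((1 - ε) * a ^ (2 * u))) ((2 : ℝ) ^ ((1 + ε) * a ^ (2 * u)))

/-- The set `b{1, 2, …} + [-r, r]`. -/
def progressionBlocks (b r : ℕ) : Set ℕ :=
  {n : ℕ | ∃ m : ℕ, 1 ≤ m ∧ |(n : ℤ) - (b : ℤ) * (m : ℤ)| ≤ (r : ℤ)}

/-- `w_1 ⋯ w_n`. -/
def weightProduct (w : ℕ → ℝ) (n : ℕ) : ℝ :=
  ∏ k ∈ Finset.Icc 1 n, w k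

/-- The products `w_1 ⋯ w_n` are at least `2^u` on `I_u^{a,ε}`, at least `2^p` on
`b_p{1, 2, …} + [-2p, 2p]`, and equal to `1` off the union of all the intervals `I_u^{a,4ε}` and
all the sets `b_p{1, 2, …} + [-4p, 4p]`. -/
structure IsBuiltFromLacunaryIntervals (a ε : ℝ) (b : ℕ → ℕ) (w : ℕ → ℝ) : Prop where
  on_interval : ∀ u n : ℕ, 2 ≤ u → (n : ℝ) ∈ lacunaryInterval a ε u →
    (2 : ℝ) ^ u ≤ weightProduct w n
  on_blocks : ∀ p n : ℕ, 1 ≤ p → n ∈ progressionBlocks (b p) (2 * p) →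
    (2 : ℝ) ^ p ≤ weightProduct w n
  off_both : ∀ n : ℕ, (∀ u : ℕ, 2 ≤ u → (n : ℝ) ∉ lacunaryInterval a (4 * ε) u) →
    (∀ p : ℕ, 1 ≤ p → n ∉ progressionBlocks (b p) (4 * p)) → weightProduct w n = 1

end

/-! Take `a = 2` and `ε = 1/8`. With `h = scale u`, the intervals `I_u^ε` and `I_u^{4ε}` are
`[2^(7h), 2^(9h)]` and `[2^(4h), 2^(12h)]`, and `h` is multiplied by 4 when `u ≥ 2` grows by 1. The
weight product is `2 ^ weightExponent n`, where the exponent is the upper envelope of plateaus with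
sides of slope one: of height `u` over `I_u^ε` and of height `p` near the multiples of `period p`.

Log-frequent hypercyclicity: on a logarithmic scale `[2^(7h+1), 2^(8h)]` is a fixed proportion of
`[1, 2^(8h)]`. The scales are shared among the targets `y p` by 2-adic valuation, so each target
owns scales whose consecutive ratio is bounded. The orbit is to approximate `y p` at the multiples
of `period p` in the intervals that `p` owns (`times p`), a set of positive lower log density
(`exists_pos_le_lowerLogDensity`). The vector `x` glues copies of `y p`, divided by the weight
products, along these times. Two copies hardly interfere, because the difference of their times
falls where the weight product is large: near a multiple of `period p` if they share a scale, in the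
interval of the larger scale otherwise (`exists_le_weightExponent_sub`).

No frequent hypercyclicity: if `|(B^n x)_0| > 1` along `E`, then the weight products tend to
infinity along `E`, because `x` is null. But at `N = 2^(13h)`, in the gap after `I_u^{4ε}`, the
intervals cover a negligible part of `[1, N]`, and the blocks with `p > s` cover at most a
proportion `2/2^s` (`card_weightExponent_gt_le`). Hence `E` has lower density zero. -/

/-- The scale `h = 2 · 4 ^ (u - 2)`, for which `a ^ (2 u) = 8 h` when `a = 2` and `u ≥ 2`. -/
def scale (u : ℕ) : ℕ := 2 * 4 ^ (u - 2)

/-- The period of the `p`-th family of blocks. -/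
def period (p : ℕ) : ℕ := 2 ^ (2 * p + 4)

theorem two_le_scale (u : ℕ) : 2 ≤ scale u := by
  have := Nat.one_le_pow (u - 2) 4 (by norm_num)
  unfold scale; omega

theorem le_scale (u : ℕ) : u ≤ scale u := by
  have : u - 2 < 4 ^ (u - 2) := Nat.lt_pow_self (by norm_num)
  unfold scale; omega

theorem scale_add {u : ℕ} (hu : 2 ≤ u) (k : ℕ) : scale (u + k) = 4 ^ k * scale u := by
  unfold scale
  rw [show u + k - 2 = (u - 2) + k by omega, pow_add]; ring

theorem scale_mono {u v : ℕ} (huv : u ≤ v) : scale u ≤ scale v := by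
  unfold scale
  have : 4 ^ (u - 2) ≤ 4 ^ (v - 2) := Nat.pow_le_pow_right (by norm_num) (by omega)
  omega

theorem four_mul_scale_le {u v : ℕ} (hu : 2 ≤ u) (huv : u < v) : 4 * scale u ≤ scale v := by
  have h1 := scale_add hu 1
  have h2 := scale_mono (show u + 1 ≤ v from huv)
  omega

theorem period_strictMono : StrictMono period := fun p q hpq =>
  Nat.pow_lt_pow_right (by norm_num) (by omega)

theorem period_pos (p : ℕ) : 0 < period p := by unfold period; positivity

theorem mul_two_pow_le_period (p : ℕ) : (8 * p + 1) * 2 ^ p ≤ period p := by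
  have h : p < 2 ^ p := Nat.lt_two_pow_self
  have : period p = (16 * 2 ^ p) * 2 ^ p := by unfold period; ring
  rw [this]
  exact Nat.mul_le_mul_right _ (by omega)

theorem lt_period (p : ℕ) : 8 * p < period p := by
  have h := mul_two_pow_le_period p
  have : 1 ≤ 2 ^ p := Nat.one_le_two_pow
  nlinarith

theorem add_lt_two_pow {a b k : ℕ} (hab : a < b) (hk : k ≤ a) : 2 ^ a + k ≤ 2 ^ b := by
  have h1 : a < 2 ^ a := Nat.lt_two_pow_self
  have h2 : 2 ^ (a + 1) ≤ 2 ^ b := Nat.pow_le_pow_right (by norm_num) hab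
  rw [pow_succ] at h2
  omega

/-! ### The weight sequence -/

/-- `k` is an admissible value for the binary logarithm of the weight product at `n`. -/
def Admissible (n k : ℕ) : Prop :=
  (∃ u, 2 ≤ u ∧ k ≤ u ∧ 2 ^ (4 * scale u) + k ≤ n ∧ n + k ≤ 2 ^ (12 * scale u)) ∨
  (∃ p m, 1 ≤ p ∧ 1 ≤ m ∧ k ≤ p ∧ n + k ≤ m * period p + 3 * p ∧ m * period p + k ≤ n + 3 * p)

theorem Admissible.le {n k : ℕ} (h : Admissible n k) : k ≤ n := by
  rcases h with ⟨u, -, -, h, -⟩ | ⟨p, m, hp, hm, hk, -, h⟩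
  · exact (Nat.le_add_left _ _).trans h
  · have := lt_period p
    have : 1 * period p ≤ m * period p := Nat.mul_le_mul_right _ hm
    omega

/-- Every side has slope one: lowering the height by 1 frees exactly the room needed to move by 1.
This makes `weightExponent` 1-Lipschitz and keeps the weights in `[1/2, 2]`. -/
theorem Admissible.sub_one {n n' k : ℕ} (h : Admissible n (k + 1)) (h1 : n' ≤ n + 1)
    (h2 : n ≤ n' + 1) : Admissible n' k := by
  rcases h with ⟨u, hu, hk, h3, h4⟩ | ⟨p, m, hp, hm, hk, h3, h4⟩
  · exact Or.inl ⟨u, hu, by omega, by omega, by omega⟩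
  · exact Or.inr ⟨p, m, hp, hm, by omega, by omega, by omega⟩

open Classical in
/-- The binary logarithm of the weight product. -/
noncomputable def weightExponent (n : ℕ) : ℕ := Nat.findGreatest (Admissible n) n

theorem le_weightExponent {n k : ℕ} (h : Admissible n k) : k ≤ weightExponent n := by
  classical exact Nat.le_findGreatest h.le h

theorem admissible_weightExponent {n : ℕ} (h : weightExponent n ≠ 0) :
    Admissible n (weightExponent n) := by
  classical exact Nat.findGreatest_of_ne_zero rfl h

theorem weightExponent_zero : weightExponent 0 = 0 := by
  classical exact Nat.findGreatest_zero

theorem weightExponent_le_add_one {n n' : ℕ} (h1 : n' ≤ n + 1) (h2 : n ≤ n' + 1) :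
    weightExponent n ≤ weightExponent n' + 1 := by
  rcases h : weightExponent n with _ | k
  · omega
  · have := admissible_weightExponent (n := n) (by omega)
    rw [h] at this
    have := le_weightExponent (this.sub_one h1 h2)
    omega

theorem le_weightExponent_of_mem_interval {u n : ℕ} (hu : 2 ≤ u) (h1 : 2 ^ (7 * scale u) ≤ n)
    (h2 : n ≤ 2 ^ (9 * scale u)) : u ≤ weightExponent n := by
  have hs := two_le_scale u
  have hl := le_scale u
  have h3 := add_lt_two_pow (show 4 * scale u < 7 * scale u by omega) (show u ≤ _ by omega)
  have h4 := add_lt_two_pow (show 9 * scale u < 12 * scale u by omega) (show u ≤ _ by omega)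
  exact le_weightExponent (Or.inl ⟨u, hu, le_rfl, by omega, by omega⟩)

theorem le_weightExponent_of_near_multiple {p m n : ℕ} (hp : 1 ≤ p) (hm : 1 ≤ m)
    (h1 : n ≤ m * period p + 2 * p) (h2 : m * period p ≤ n + 2 * p) : p ≤ weightExponent n :=
  le_weightExponent (Or.inr ⟨p, m, hp, hm, le_rfl, by omega, by omega⟩)

/-- The weight sequence. -/
noncomputable def weight (n : ℕ) : ℝ := 2 ^ weightExponent n / 2 ^ weightExponent (n - 1)

theorem weight_succ_mul (n : ℕ) :
    weight (n + 1) * 2 ^ weightExponent n = 2 ^ weightExponent (n + 1) := by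
  simp [weight]

theorem weight_bounds (n : ℕ) : 1 / 2 ≤ weight n ∧ weight n ≤ 2 := by
  have h1 := weightExponent_le_add_one (n := n) (n' := n - 1) (by omega) (by omega)
  have h2 := weightExponent_le_add_one (n := n - 1) (n' := n) (by omega) (by omega)
  have h3 : (2 : ℝ) ^ weightExponent n ≤ 2 ^ (weightExponent (n - 1) + 1) :=
    pow_le_pow_right₀ (by norm_num) h1
  have h4 : (2 : ℝ) ^ weightExponent (n - 1) ≤ 2 ^ (weightExponent n + 1) :=
    pow_le_pow_right₀ (by norm_num) h2
  rw [pow_succ] at h3 h4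
  unfold weight
  constructor
  · rw [le_div_iff₀ (by positivity)]; linarith
  · rw [div_le_iff₀ (by positivity)]; linarith

theorem weightProduct_weight (n : ℕ) : weightProduct weight n = 2 ^ weightExponent n := by
  induction n with
  | zero => simp [weightProduct, weightExponent_zero]
  | succ n ih =>
    unfold weightProduct at ih ⊢
    rw [Finset.prod_Icc_succ_top (by omega), ih, mul_comm, weight_succ_mul]

/-- Turns the real exponents into natural ones; it is used with `δ = 1/8` (7 and 9) and `δ = 1/2` (4
and 12). -/
theorem mem_lacunaryInterval_iff {u n : ℕ} (hu : 2 ≤ u) (δ : ℝ) (i j : ℕ)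
    (hi : 8 * (1 - δ) = i) (hj : 8 * (1 + δ) = j) :
    (n : ℝ) ∈ lacunaryInterval 2 δ u ↔ 2 ^ (i * scale u) ≤ n ∧ n ≤ 2 ^ (j * scale u) := by
  have h : (2 : ℝ) ^ (2 * u) = 8 * scale u := by
    obtain ⟨k, rfl⟩ := Nat.exists_eq_add_of_le hu
    have : ((2 : ℝ) ^ 2) ^ k = 4 ^ k := by norm_num
    simp only [scale, Nat.add_sub_cancel_left, mul_add, pow_add, pow_mul, this]
    push_cast; ring
  unfold lacunaryInterval
  rw [h, show (1 - δ) * (8 * (scale u : ℝ)) = ((i * scale u : ℕ) : ℝ) by push_cast; rw [← hi]; ring,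
    show (1 + δ) * (8 * (scale u : ℝ)) = ((j * scale u : ℕ) : ℝ) by push_cast; rw [← hj]; ring,
    Real.rpow_natCast, Real.rpow_natCast, Set.mem_Icc]
  norm_cast

theorem isBuiltFromLacunaryIntervals_weight :
    IsBuiltFromLacunaryIntervals 2 (1 / 8) period weight := by
  refine ⟨fun u n hu hn => ?_, fun p n hp hn => ?_, fun n hn hn' => ?_⟩
  · rw [mem_lacunaryInterval_iff hu _ 7 9 (by norm_num) (by norm_num)] at hn
    rw [weightProduct_weight]
    exact pow_le_pow_right₀ (by norm_num) (le_weightExponent_of_mem_interval hu hn.1 hn.2)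
  · obtain ⟨m, hm, h⟩ := hn
    rw [abs_le] at h
    rw [weightProduct_weight]
    have h1 : n ≤ m * period p + 2 * p := by zify; push_cast at h; linarith
    have h2 : m * period p ≤ n + 2 * p := by zify; push_cast at h; linarith
    exact pow_le_pow_right₀ (by norm_num) (le_weightExponent_of_near_multiple hp hm h1 h2)
  · rw [weightProduct_weight]
    suffices h : weightExponent n = 0 by rw [h, pow_zero]
    by_contra h0
    rcases admissible_weightExponent h0 with ⟨u, hu, -, h1, h2⟩ | ⟨p, m, hp, hm, -, h1, h2⟩
    · refine hn u hu ?_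
      rw [mem_lacunaryInterval_iff hu _ 4 12 (by norm_num) (by norm_num)]
      omega
    · refine hn' p hp ⟨m, hm, ?_⟩
      rw [abs_le]
      zify at h1 h2
      push_cast
      constructor <;> nlinarith

/-! ### The space of null sequences and its backward shifts -/

section NullSequences

variable {𝕜 : Type*} [RCLike 𝕜]

theorem tendsto_nullSequence (x : C₀(ℕ, 𝕜)) : Tendsto x atTop (nhds 0) := by
  have := x.zero_at_infty'
  rwa [cocompact_eq_cofinite, Nat.cofinite_eq_atTop] at this

/-- The element of `c₀` given by a null sequence. -/
def nullSequence (x : ℕ → 𝕜) (hx : Tendsto x atTop (nhds 0)) : C₀(ℕ, 𝕜) where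
  toFun := x
  continuous_toFun := continuous_of_discreteTopology
  zero_at_infty' := by rwa [cocompact_eq_cofinite, Nat.cofinite_eq_atTop]

@[simp] theorem nullSequence_apply (x : ℕ → 𝕜) (hx : Tendsto x atTop (nhds 0)) (n : ℕ) :
    nullSequence x hx n = x n := rfl

theorem norm_apply_le (x : C₀(ℕ, 𝕜)) (n : ℕ) : ‖x n‖ ≤ ‖x‖ :=
  x.toBCF.norm_coe_le_norm n

theorem norm_le_of_forall_apply_le {x : C₀(ℕ, 𝕜)} {C : ℝ} (hC : 0 ≤ C) (h : ∀ n, ‖x n‖ ≤ C) :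
    ‖x‖ ≤ C :=
  (BoundedContinuousFunction.norm_le (f := x.toBCF) hC).2 h

theorem tendsto_mul_of_norm_le_two {c y : ℕ → 𝕜} (hc : ∀ n, ‖c n‖ ≤ 2)
    (hy : Tendsto y atTop (nhds 0)) : Tendsto (fun n => c n * y n) atTop (nhds 0) := by
  refine squeeze_zero_norm (a := fun n => 2 * ‖y n‖) (fun n => ?_) ?_
  · rw [norm_mul]
    exact mul_le_mul_of_nonneg_right (hc n) (norm_nonneg _)
  · simpa using hy.norm.const_mul 2

/-- The weighted composition operator `x ↦ (c n * x (σ n))_n` on `c₀`, for weights bounded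
by `2`. -/
noncomputable def weightedComposition (c : ℕ → 𝕜) (σ : ℕ → ℕ) (hc : ∀ n, ‖c n‖ ≤ 2)
    (hσ : Tendsto σ atTop atTop) : C₀(ℕ, 𝕜) →L[𝕜] C₀(ℕ, 𝕜) :=
  LinearMap.mkContinuous
    { toFun := fun x => nullSequence (fun n => c n * x (σ n))
        (tendsto_mul_of_norm_le_two hc ((tendsto_nullSequence x).comp hσ))
      map_add' := fun x y => by ext n; simp [mul_add]
      map_smul' := fun r x => by ext n; simp [mul_left_comm] }
    2 (fun x => norm_le_of_forall_apply_le (by positivity) fun n => by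
      simp only [LinearMap.coe_mk, AddHom.coe_mk, nullSequence_apply, norm_mul]
      exact mul_le_mul (hc n) (norm_apply_le x _) (norm_nonneg _) (by norm_num))

@[simp] theorem weightedComposition_apply (c : ℕ → 𝕜) (σ : ℕ → ℕ) (hc : ∀ n, ‖c n‖ ≤ 2)
    (hσ : Tendsto σ atTop atTop) (x : C₀(ℕ, 𝕜)) (n : ℕ) :
    weightedComposition c σ hc hσ x n = c n * x (σ n) := rfl

theorem exists_isWeightedBackwardShift {w : ℕ → ℝ} (hw : ∀ n, 1 / 2 ≤ w n ∧ w n ≤ 2) :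
    ∃ B : C₀(ℕ, 𝕜) →L[𝕜] C₀(ℕ, 𝕜), IsWeightedBackwardShift w B ∧
      ∃ S : C₀(ℕ, 𝕜) →L[𝕜] C₀(ℕ, 𝕜), B ∘L S = ContinuousLinearMap.id 𝕜 C₀(ℕ, 𝕜) := by
  have hpos : ∀ n, 0 < w n := fun n => by linarith [(hw n).1]
  have hn : ∀ n, ‖(w n : 𝕜)‖ = w n := fun n => by
    rw [RCLike.norm_ofReal, abs_of_pos (hpos n)]
  refine ⟨weightedComposition (fun n => (w (n + 1) : 𝕜)) (fun n => n + 1)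
    (fun n => (hn _).trans_le (hw _).2) (tendsto_add_atTop_nat 1), fun x n => rfl,
    weightedComposition (fun n => if n = 0 then 0 else (w n : 𝕜)⁻¹) (fun n => n - 1)
    (fun n => ?_) (tendsto_sub_atTop_nat 1), ?_⟩
  · split_ifs
    · simp
    · rw [norm_inv, hn, inv_le_comm₀ (hpos n) (by norm_num)]
      linarith [(hw n).1]
  · ext x n
    have : (w (n + 1) : 𝕜) ≠ 0 := by exact_mod_cast (hpos _).ne'
    simp [this]

/-- The iterates of the backward shift with the weight sequence `weight`. -/
theorem shift_pow_apply_mul {B : C₀(ℕ, 𝕜) →L[𝕜] C₀(ℕ, 𝕜)} (hB : IsWeightedBackwardShift weight B)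
    (x : C₀(ℕ, 𝕜)) (n k : ℕ) :
    (B ^ n) x k * 2 ^ weightExponent k = 2 ^ weightExponent (n + k) * x (n + k) := by
  induction n generalizing x with
  | zero => simp [mul_comm]
  | succ n ih =>
    have h := congrArg (fun r : ℝ => (r : 𝕜)) (weight_succ_mul (n + k))
    push_cast at h
    rw [pow_succ, mul_apply_eq_comp, ih, hB, show n + 1 + k = n + k + 1 by omega, ← h]
    ring

/-- A sequence of finitely supported vectors with slowly growing weighted norms that visits every
ball of `c₀` infinitely often. -/
theorem exists_slowly_growing_dense_vectors (W : ℕ → ℝ) :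
    ∃ y : ℕ → ℕ → 𝕜, (∀ p k, p < k → y p k = 0) ∧ (∀ p k, ‖y p k‖ * W k ≤ p) ∧
      ∀ (x : C₀(ℕ, 𝕜)) (δ : ℝ), 0 < δ → ∀ P : ℕ, ∃ p, P ≤ p ∧ ∀ k, ‖y p k - x k‖ ≤ δ := by
  classical
  obtain ⟨e, he⟩ := exists_surjective_nat (Σ N : ℕ, Fin N → ℕ)
  let z : ℕ → ℕ → 𝕜 := fun j k =>
    if h : k < (e j).1 then TopologicalSpace.denseSeq 𝕜 ((e j).2 ⟨k, h⟩) else 0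
  let good : ℕ → ℕ → Prop := fun p j => (∀ k, p < k → z j k = 0) ∧ ∀ k, ‖z j k‖ * W k ≤ p
  -- Unpairing `p` lists each candidate `z j` infinitely often; it is replaced by 0 as long as it
  -- breaks the bounds required at stage `p`, which happens only for finitely many `p`.
  refine ⟨fun p k => if good p p.unpair.1 then z p.unpair.1 k else 0, fun p k hk => ?_,
    fun p k => ?_, fun x δ hδ P => ?_⟩
  · dsimp only
    split_ifs with h
    exacts [h.1 k hk, rfl]
  · dsimp only
    split_ifs with h
    exacts [h.2 k, by simp]
  · obtain ⟨N, hN⟩ := Filter.eventually_atTop.1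
      (Metric.tendsto_nhds.1 (tendsto_nullSequence x) δ hδ)
    have hd : ∀ k, ∃ i, ‖TopologicalSpace.denseSeq 𝕜 i - x k‖ ≤ δ := fun k => by
      obtain ⟨i, h⟩ := (TopologicalSpace.denseRange_denseSeq 𝕜).exists_mem_open
        Metric.isOpen_ball ⟨x k, Metric.mem_ball_self hδ⟩
      exact ⟨i, (mem_ball_iff_norm.1 h).le⟩
    choose i hi using hd
    obtain ⟨j, hj⟩ := he ⟨N, fun k => i k⟩
    have hz : ∀ k, z j k = if k < N then TopologicalSpace.denseSeq 𝕜 (i k) else 0 := fun k => by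
      simp only [z]; rw [hj]; rfl
    have hz0 : ∀ k, N ≤ k → z j k = 0 := fun k hk => by rw [hz, if_neg (by omega)]
    obtain ⟨C, hC⟩ := ((Finset.range N).image fun k => ⌈‖z j k‖ * W k⌉₊).exists_le
    have hle : P + N + C ≤ Nat.pair j (P + N + C) := Nat.right_le_pair _ _
    have hgood : good (Nat.pair j (P + N + C)) j := by
      refine ⟨fun k hk => hz0 k (by omega), fun k => ?_⟩
      by_cases hk : k < N
      · have h1 := hC _ (Finset.mem_image_of_mem _ (Finset.mem_range.2 hk))
        exact (Nat.le_ceil _).trans (by exact_mod_cast h1.trans (by omega))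
      · rw [hz0 k (by omega)]; simp
    refine ⟨Nat.pair j (P + N + C), by omega, fun k => ?_⟩
    simp only [Nat.unpair_pair, if_pos hgood, hz]
    split_ifs with hk
    · exact hi k
    · have := hN k (by omega)
      rw [dist_zero_right] at this
      rw [zero_sub, norm_neg]
      exact this.le

end NullSequences

/-! ### Harmonic sums and the logarithmic density of the approximation times -/

section Densities

theorem weightedRatio_bounds {α : ℕ → ℝ} (hα : ∀ k, 0 ≤ α k) (E : Set ℕ) (n : ℕ) :
    0 ≤ (∑ k ∈ Finset.Icc 1 n, E.indicator α k) / (∑ k ∈ Finset.Icc 1 n, α k) ∧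
    (∑ k ∈ Finset.Icc 1 n, E.indicator α k) / (∑ k ∈ Finset.Icc 1 n, α k) ≤ 1 := by
  have h := Finset.sum_nonneg fun k (_ : k ∈ Finset.Icc 1 n) => hα k
  exact ⟨div_nonneg (Finset.sum_nonneg fun k _ => Set.indicator_nonneg (fun k _ => hα k) k) h,
    div_le_one_of_le₀ (Finset.sum_le_sum fun k _ => Set.indicator_le_self' (fun _ _ => hα _) _) h⟩

theorem le_lowerWeightedDensity {α : ℕ → ℝ} (hα : ∀ k, 0 ≤ α k) {E : Set ℕ} {c : ℝ}
    (h : ∀ᶠ n in atTop, c ≤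
      (∑ k ∈ Finset.Icc 1 n, E.indicator α k) / (∑ k ∈ Finset.Icc 1 n, α k)) :
    c ≤ lowerWeightedDensity α E :=
  le_liminf_of_le
    (isBoundedUnder_of ⟨1, fun n => (weightedRatio_bounds hα E n).2⟩).isCoboundedUnder_ge h

theorem eventually_lt_of_lt_lowerWeightedDensity {α : ℕ → ℝ} (hα : ∀ k, 0 ≤ α k) {E : Set ℕ}
    {c : ℝ} (h : c < lowerWeightedDensity α E) : ∀ᶠ n in atTop, c <
      (∑ k ∈ Finset.Icc 1 n, E.indicator α k) / (∑ k ∈ Finset.Icc 1 n, α k) :=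
  eventually_lt_of_lt_liminf h (isBoundedUnder_of ⟨0, fun n => (weightedRatio_bounds hα E n).1⟩)

/-- Each dyadic block contributes at least 1/2. -/
theorem half_le_sum_inv_dyadic {a b : ℕ} (hab : a ≤ b) :
    ((b : ℝ) - a) / 2 ≤ ∑ k ∈ Finset.Ioc (2 ^ a) (2 ^ b), ((k : ℕ) : ℝ)⁻¹ := by
  induction b, hab using Nat.le_induction with
  | base => simp
  | succ b hab ih =>
    have h1 : 2 ^ a ≤ 2 ^ b := Nat.pow_le_pow_right (by norm_num) hab
    have h2 : 2 ^ b ≤ 2 ^ (b + 1) := Nat.pow_le_pow_right (by norm_num) (by omega)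
    rw [← Finset.sum_Ioc_consecutive _ h1 h2]
    have h3 : (1 / 2 : ℝ) ≤ ∑ k ∈ Finset.Ioc (2 ^ b) (2 ^ (b + 1)), ((k : ℕ) : ℝ)⁻¹ := by
      have : ∀ k : ℕ, k ∈ Finset.Ioc (2 ^ b) (2 ^ (b + 1)) → ((2 : ℝ) ^ (b + 1))⁻¹ ≤ (k : ℝ)⁻¹ := by
        intro k hk
        rw [Finset.mem_Ioc] at hk
        have hk0 : 0 < k := (Nat.zero_le _).trans_lt hk.1
        exact inv_anti₀ (by exact_mod_cast hk0) (by exact_mod_cast hk.2)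
      have := Finset.card_nsmul_le_sum _ _ _ this
      rw [Nat.card_Ioc, show 2 ^ (b + 1) - 2 ^ b = 2 ^ b by rw [pow_succ]; omega, nsmul_eq_mul,
        pow_succ, mul_inv, ← mul_assoc] at this
      push_cast at this
      rw [mul_inv_cancel₀ (by positivity)] at this
      linarith
    push_cast
    linarith

theorem sum_inv_le_of_lt_two_pow {N b : ℕ} (h : N < 2 ^ b) :
    ∑ k ∈ Finset.Icc 1 N, ((k : ℕ) : ℝ)⁻¹ ≤ b := by
  have key : ∀ b : ℕ, ∑ k ∈ Finset.Ico 1 (2 ^ b), ((k : ℕ) : ℝ)⁻¹ ≤ b := by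
    intro b
    induction b with
    | zero => simp
    | succ b ih =>
      have h1 : 1 ≤ 2 ^ b := Nat.one_le_two_pow
      have h2 : 2 ^ b ≤ 2 ^ (b + 1) := Nat.pow_le_pow_right (by norm_num) (by omega)
      rw [← Finset.sum_Ico_consecutive _ h1 h2]
      have : ∀ k : ℕ, k ∈ Finset.Ico (2 ^ b) (2 ^ (b + 1)) → (k : ℝ)⁻¹ ≤ ((2 : ℝ) ^ b)⁻¹ := by
        intro k hk
        rw [Finset.mem_Ico] at hk
        exact inv_anti₀ (by positivity) (by exact_mod_cast hk.1)
      have := Finset.sum_le_card_nsmul _ _ _ this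
      rw [Nat.card_Ico, show 2 ^ (b + 1) - 2 ^ b = 2 ^ b by rw [pow_succ]; omega,
        nsmul_eq_mul] at this
      push_cast at this
      rw [mul_inv_cancel₀ (by positivity)] at this
      push_cast
      linarith
  refine (Finset.sum_le_sum_of_subset_of_nonneg (fun k hk => ?_) fun k _ _ => by positivity).trans
    (key b)
  rw [Finset.mem_Icc] at hk
  rw [Finset.mem_Ico]
  omega

/-- The places `2 ^ p (2 k + 1)` of the scales that serve the `p`-th target vector. -/
def place (p k : ℕ) : ℕ := 2 ^ p * (2 * k + 1)

theorem lt_place (p k : ℕ) : p < place p k :=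
  (Nat.lt_two_pow_self (n := p)).trans_le (Nat.le_mul_of_pos_right _ (by omega))

theorem le_place (p k : ℕ) : k ≤ place p k := by
  have : 1 ≤ 2 ^ p := Nat.one_le_two_pow
  unfold place
  nlinarith

/-- The index `p` is the 2-adic valuation of `place p k`. -/
theorem place_index_eq {p q k l : ℕ} (h : place p k = place q l) : p = q := by
  have key : ∀ {p q k l : ℕ}, place p k = place q l → ¬ p < q := by
    intro p q k l h hpq
    obtain ⟨d, rfl⟩ := Nat.exists_eq_add_of_lt hpq
    unfold place at h
    rw [show p + d + 1 = p + (d + 1) by omega, pow_add, mul_assoc] at h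
    have := Nat.eq_of_mul_eq_mul_left (by positivity) h
    rw [pow_succ, mul_comm _ 2, mul_assoc] at this
    omega
  have h1 := key h
  have h2 := key h.symm
  omega

/-- The times at which the orbit approximates the `p`-th target vector. -/
def times (p : ℕ) : Set ℕ :=
  {n | ∃ k, period p ∣ n ∧ 2 ^ (7 * scale (place p k) + 1) ≤ n ∧ n ≤ 2 ^ (8 * scale (place p k))}

/-- The multiples of `period p` in the last interval alone suffice: since the period is a power of
2, dividing by it leaves a dyadic range of length `h - 1 ≥ h / 2` in the exponent. -/
theorem sum_inv_times_ge {p k N : ℕ} (hp : 1 ≤ p) (hN : 2 ^ (8 * scale (place p k)) ≤ N) :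
    (scale (place p k) : ℝ) / (4 * period p) ≤
      ∑ n ∈ Finset.Icc 1 N, (times p).indicator (fun n => (n : ℝ)⁻¹) n := by
  set h := scale (place p k) with hh
  have h1 : 2 ≤ h := two_le_scale _
  have h2 : p + 1 ≤ h := (lt_place p k).trans_le (le_scale _)
  have hpow : ∀ i, 2 * p + 4 ≤ i → period p * 2 ^ (i - (2 * p + 4)) = 2 ^ i := fun i hi => by
    rw [period, ← pow_add]; congr 1; omega
  have ha := hpow (7 * h + 1) (by omega)
  have hb := hpow (8 * h) (by omega)
  set a := 7 * h + 1 - (2 * p + 4) with haa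
  set b := 8 * h - (2 * p + 4) with hbb
  have hab : a ≤ b := by omega
  have hdiff : (h : ℝ) / 2 ≤ (b : ℝ) - a := by
    have : b + 1 = a + h := by omega
    have : (b : ℝ) + 1 = a + h := by exact_mod_cast this
    have : (2 : ℝ) ≤ h := by exact_mod_cast h1
    linarith
  have hper : (0 : ℝ) < period p := by exact_mod_cast period_pos p
  calc (h : ℝ) / (4 * period p) = (period p : ℝ)⁻¹ * ((h : ℝ) / 2 / 2) := by
        field_simp; ring
    _ ≤ (period p : ℝ)⁻¹ * ∑ j ∈ Finset.Ioc (2 ^ a) (2 ^ b), ((j : ℕ) : ℝ)⁻¹ := by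
        have := half_le_sum_inv_dyadic hab
        gcongr
        linarith
    _ = ∑ j ∈ Finset.Ioc (2 ^ a) (2 ^ b),
          (times p).indicator (fun n => (n : ℝ)⁻¹) (period p * j) := by
        rw [Finset.mul_sum]
        refine Finset.sum_congr rfl fun j hj => ?_
        rw [Finset.mem_Ioc] at hj
        rw [Set.indicator_of_mem]
        · push_cast; rw [mul_inv]
        · refine ⟨k, dvd_mul_right _ _, ?_, ?_⟩
          · rw [← hh, ← ha]; exact Nat.mul_le_mul_left _ hj.1.le
          · rw [← hh, ← hb]; exact Nat.mul_le_mul_left _ hj.2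
    _ = ∑ n ∈ (Finset.Ioc (2 ^ a) (2 ^ b)).image (period p * ·),
          (times p).indicator (fun n => (n : ℝ)⁻¹) n := by
        rw [Finset.sum_image]
        intro i _ j _ hij
        exact Nat.eq_of_mul_eq_mul_left (period_pos p) hij
    _ ≤ _ := by
        refine Finset.sum_le_sum_of_subset_of_nonneg (fun n hn => ?_) fun n _ _ =>
          Set.indicator_nonneg (fun n _ => by positivity) n
        obtain ⟨j, hj, rfl⟩ := Finset.mem_image.1 hn
        rw [Finset.mem_Ioc] at hj
        have h3 : 1 ≤ period p * j :=
          Nat.mul_pos (period_pos p) (lt_of_le_of_lt (Nat.zero_le _) hj.1)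
        have h4 : period p * j ≤ period p * 2 ^ b := Nat.mul_le_mul_left _ hj.2
        rw [Finset.mem_Icc]
        omega

theorem exists_pos_le_lowerLogDensity {p : ℕ} (hp : 1 ≤ p) {E : Set ℕ} (hE : times p ⊆ E) :
    0 < lowerLogDensity E := by
  -- Consecutive places of `p` differ by `2 ^ (p + 1)`, and each unit multiplies the scale by 4. Up
  -- to the next right endpoint the harmonic sum is at most `8 D h`, against a gain of `h / (4 *
  -- period p)`.
  set D : ℕ := 4 ^ 2 ^ (p + 1) with hD
  have hper : (0 : ℝ) < period p := by exact_mod_cast period_pos p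
  have hDpos : (0 : ℝ) < D := by rw [hD]; positivity
  refine lt_of_lt_of_le (show (0 : ℝ) < 1 / (32 * period p * D) by positivity)
    (le_lowerWeightedDensity (fun k => by positivity) ?_)
  filter_upwards [eventually_ge_atTop (2 ^ (8 * scale (place p 0)))] with N hN
  have hex : ∃ k, N < 2 ^ (8 * scale (place p k)) := ⟨N, by
    have h1 : N ≤ 8 * scale (place p N) := by
      have := (le_place p N).trans (le_scale _); omega
    exact h1.trans_lt Nat.lt_two_pow_self⟩
  classical
  obtain ⟨k, hk1, hk2⟩ : ∃ k, 2 ^ (8 * scale (place p k)) ≤ N ∧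
      N < 2 ^ (8 * scale (place p (k + 1))) := by
    rcases hf : Nat.find hex with _ | k
    · have := Nat.find_spec hex
      rw [hf] at this; omega
    · exact ⟨k, not_lt.1 (Nat.find_min hex (by omega)), hf ▸ Nat.find_spec hex⟩
  have hs : scale (place p (k + 1)) = D * scale (place p k) := by
    rw [hD, ← scale_add (by have := lt_place p k; omega)]
    congr 1; unfold place; ring
  have h1 := sum_inv_times_ge hp hk1
  have h2 := sum_inv_le_of_lt_two_pow hk2
  rw [hs] at h2
  push_cast at h2
  have h3 : ∑ n ∈ Finset.Icc 1 N, (times p).indicator (fun n : ℕ => (n : ℝ)⁻¹) n ≤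
      ∑ n ∈ Finset.Icc 1 N, E.indicator (fun n : ℕ => (n : ℝ)⁻¹) n :=
    Finset.sum_le_sum fun n _ =>
      Set.indicator_le_indicator_of_subset hE (fun n => by positivity) n
  have hN1 : 1 ≤ N := Nat.one_le_two_pow.trans hN
  have hpos : 0 < ∑ n ∈ Finset.Icc 1 N, ((n : ℕ) : ℝ)⁻¹ :=
    Finset.sum_pos (fun n hn => by
      rw [Finset.mem_Icc] at hn
      have : (0 : ℝ) < n := by exact_mod_cast hn.1
      positivity) ⟨1, by simpa using hN1⟩
  rw [le_div_iff₀ hpos]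
  calc 1 / (32 * period p * D) * ∑ n ∈ Finset.Icc 1 N, ((n : ℕ) : ℝ)⁻¹
      ≤ 1 / (32 * period p * D) * (8 * (D * scale (place p k))) := by gcongr
    _ = scale (place p k) / (4 * period p) := by field_simp; ring
    _ ≤ _ := h1.trans h3

end Densities

/-! ### Separation of the times, gluing, and log-frequent hypercyclicity -/

section Hypercyclicity

theorem two_pow_scale_lt {u v : ℕ} (hu : 2 ≤ u) (huv : u < v) :
    2 ^ (8 * scale u) + u < 2 ^ (7 * scale v + 1) := by
  have h1 := four_mul_scale_le hu huv
  have h2 := le_scale u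
  have h3 := two_le_scale u
  have h4 := add_lt_two_pow (show 8 * scale u < 8 * scale u + 1 by omega) (show u ≤ _ by omega)
  exact h4.trans_lt (Nat.pow_lt_pow_right (by norm_num) (by omega))

theorem place_le_of_times {p q k l m m' : ℕ} (hq : 1 ≤ q)
    (hm : 2 ^ (7 * scale (place p k) + 1) ≤ m) (hm' : m' ≤ 2 ^ (8 * scale (place q l)))
    (h : m ≤ m') : place p k ≤ place q l := by
  by_contra! hlt
  have := two_pow_scale_lt (by have := lt_place q l; omega) hlt
  omega

theorem times_index_eq {p q m : ℕ} (hp : 1 ≤ p) (hq : 1 ≤ q) (hm : m ∈ times p)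
    (hm' : m ∈ times q) : p = q := by
  obtain ⟨k, -, h1, h2⟩ := hm
  obtain ⟨l, -, h3, h4⟩ := hm'
  exact place_index_eq ((place_le_of_times hq h1 h4 le_rfl).antisymm
    (place_le_of_times hp h3 h2 le_rfl))

/-- This makes the supports `[m, m + p]` of the glued copies disjoint: times at the same place
differ by at least a period, and different places are far apart. -/
theorem add_lt_of_times_of_lt {p q m m' : ℕ} (hp : 1 ≤ p) (hq : 1 ≤ q) (hm : m ∈ times p)
    (hm' : m' ∈ times q) (hlt : m < m') : m + p < m' := by
  obtain ⟨k, hd, h1, h2⟩ := hm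
  obtain ⟨l, hd', h3, h4⟩ := hm'
  have hk := lt_place p k
  rcases (place_le_of_times hq h1 h4 hlt.le).eq_or_lt with h | h
  · obtain rfl := place_index_eq h
    have := Nat.le_of_dvd (by omega) (Nat.dvd_sub hd' hd)
    have := lt_period p
    omega
  · have := two_pow_scale_lt (by omega) h
    omega

/-- At equal places `p = q` and the difference is a multiple of the period. Otherwise `m ≤ 2 ^ (7h)`
and `m' ≥ 2 ^ (7h + 1)` for the scale `h` of `m'`, so the difference stays in the interval of that
scale; this is why the times start at `7h + 1`. -/
theorem exists_le_weightExponent_sub {p q m m' t : ℕ} (hp : 1 ≤ p) (hq : 1 ≤ q)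
    (hm : m ∈ times p) (hm' : m' ∈ times q) (hlt : m < m') (ht : t ≤ q) :
    ∃ v, p ≤ v ∧ q ≤ v ∧ v ≤ weightExponent (m' - m + t) := by
  obtain ⟨k, hd, h1, h2⟩ := hm
  obtain ⟨l, hd', h3, h4⟩ := hm'
  have hk := lt_place p k
  have hl := lt_place q l
  rcases (place_le_of_times hq h1 h4 hlt.le).eq_or_lt with h | h
  · obtain rfl := place_index_eq h
    obtain ⟨j, hj⟩ := Nat.dvd_sub hd' hd
    have hj1 : 1 ≤ j := by
      rcases j with _ | j <;> omega
    rw [mul_comm] at hj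
    exact ⟨p, le_rfl, le_rfl, le_weightExponent_of_near_multiple hp hj1 (by omega) (by omega)⟩
  · refine ⟨place q l, by omega, by omega,
      le_weightExponent_of_mem_interval (by omega) ?_ ?_⟩
    · have h5 := four_mul_scale_le (show 2 ≤ place p k by omega) h
      have h6 : 2 ^ (8 * scale (place p k)) ≤ 2 ^ (7 * scale (place q l)) :=
        Nat.pow_le_pow_right (by norm_num) (by omega)
      rw [pow_succ] at h3
      omega
    · have h5 := le_scale (place q l)
      have h6 := two_le_scale (place q l)
      have h7 := add_lt_two_pow
        (show 8 * scale (place q l) < 9 * scale (place q l) by omega) (show t ≤ _ by omega)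
      omega

/-- The last bound forces `v` to tend to infinity with `m`, which makes the glued sequence null. -/
theorem exists_le_weightExponent_add {p m t : ℕ} (hp : 1 ≤ p) (hm : m ∈ times p) (ht : t ≤ p) :
    ∃ v, p ≤ v ∧ v ≤ weightExponent (m + t) ∧ m + t ≤ 2 ^ (9 * scale v) := by
  obtain ⟨k, -, h1, h2⟩ := hm
  have hk := lt_place p k
  have h5 := le_scale (place p k)
  have h6 := two_le_scale (place p k)
  have h7 := add_lt_two_pow
    (show 8 * scale (place p k) < 9 * scale (place p k) by omega) (show t ≤ _ by omega)
  rw [pow_succ] at h1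
  exact ⟨place p k, hk.le, le_weightExponent_of_mem_interval (by omega) (by omega) (by omega),
    by omega⟩

theorem sq_le_two_mul_two_pow (v : ℕ) : v * v ≤ 2 * 2 ^ v := by
  by_cases hv : 3 ≤ v
  · induction v, hv using Nat.le_induction with
    | base => norm_num
    | succ v hv ih => rw [pow_succ]; nlinarith
  · interval_cases v <;> norm_num

/-- From `v ^ 2 ≤ 2 * 2 ^ v` one gets `r ≤ v / 2 ^ v ≤ 2 / v ≤ 2 / p`. -/
theorem le_two_div_of_mul_two_pow_le {r : ℝ} {p v n : ℕ} (hr : 0 ≤ r) (hp : 1 ≤ p) (hpv : p ≤ v)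
    (hvn : v ≤ n) (h : r * 2 ^ n ≤ v) : r ≤ 2 / p := by
  have h1 : (v : ℝ) * v ≤ 2 * 2 ^ v := by exact_mod_cast sq_le_two_mul_two_pow v
  have h2 : r * 2 ^ v ≤ v :=
    (mul_le_mul_of_nonneg_left (pow_le_pow_right₀ (by norm_num) hvn) hr).trans h
  have hp' : (1 : ℝ) ≤ p := by exact_mod_cast hp
  have hv' : (p : ℝ) ≤ v := by exact_mod_cast hpv
  have h3 : (r * v) * v ≤ 2 * v :=
    calc (r * v) * v = r * (v * v) := by ring
      _ ≤ r * (2 * 2 ^ v) := by gcongr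
      _ = 2 * (r * 2 ^ v) := by ring
      _ ≤ 2 * v := by gcongr
  have h4 : r * v ≤ 2 := le_of_mul_le_mul_right h3 (by linarith)
  rw [le_div_iff₀ (by linarith)]
  exact (mul_le_mul_of_nonneg_left hv' hr).trans h4

variable {𝕜 : Type*} [RCLike 𝕜]

theorem norm_mul_two_pow_eq {a b : 𝕜} {i j : ℕ} (h : a * 2 ^ i = b * 2 ^ j) :
    ‖a‖ * 2 ^ i = ‖b‖ * 2 ^ j := by
  simpa using congrArg norm h

/-- Weighted copies of the vectors `y p` can be glued along the sets `times p`. -/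
theorem exists_glued_sequence (y : ℕ → ℕ → 𝕜) :
    ∃ x : ℕ → 𝕜, (∀ p m t, 1 ≤ p → m ∈ times p → t ≤ p →
        x (m + t) * 2 ^ weightExponent (m + t) = y p t * 2 ^ weightExponent t) ∧
      ∀ n, x n ≠ 0 → ∃ p m t, 1 ≤ p ∧ m ∈ times p ∧ t ≤ p ∧ n = m + t := by
  classical
  let Q : ℕ → ℕ × ℕ × ℕ → Prop := fun n s =>
    1 ≤ s.1 ∧ s.2.1 ∈ times s.1 ∧ s.2.2 ≤ s.1 ∧ n = s.2.1 + s.2.2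
  have huniq : ∀ n s s', Q n s → Q n s' → s = s' := by
    rintro n ⟨p, m, t⟩ ⟨q, m', t'⟩ ⟨h1, h2, h3, h4⟩ ⟨h1', h2', h3', h4'⟩
    dsimp only at h1 h2 h3 h4 h1' h2' h3' h4'
    obtain hlt | rfl | hlt := lt_trichotomy m m'
    · have := add_lt_of_times_of_lt h1 h1' h2 h2' hlt; omega
    · obtain rfl := times_index_eq h1 h1' h2 h2'
      obtain rfl : t = t' := by omega
      rfl
    · have := add_lt_of_times_of_lt h1' h1 h2' h2 hlt; omega
  refine ⟨fun n => if h : ∃ s, Q n s then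
    y h.choose.1 h.choose.2.2 * 2 ^ weightExponent h.choose.2.2 / 2 ^ weightExponent n else 0,
    fun p m t hp hm ht => ?_, fun n hn => ?_⟩
  · have h : ∃ s, Q (m + t) s := ⟨(p, m, t), hp, hm, ht, rfl⟩
    have hs : h.choose = (p, m, t) := huniq _ _ _ h.choose_spec ⟨hp, hm, ht, rfl⟩
    dsimp only
    rw [dif_pos h, div_mul_cancel₀ _ (pow_ne_zero _ two_ne_zero), hs]
  · by_cases h : ∃ s, Q n s
    · obtain ⟨⟨p, m, t⟩, h⟩ := h
      exact ⟨p, m, t, h⟩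
    · exact absurd (dif_neg h) hn

theorem logFrequentlyHypercyclic_of_weight {B : C₀(ℕ, 𝕜) →L[𝕜] C₀(ℕ, 𝕜)}
    (hB : IsWeightedBackwardShift weight B) : LogFrequentlyHypercyclic B := by
  obtain ⟨y, hy0, hyW, hyd⟩ :=
    exists_slowly_growing_dense_vectors (𝕜 := 𝕜) (fun k => 2 ^ weightExponent k)
  obtain ⟨x, hx, hx0⟩ := exists_glued_sequence y
  have hxlim : Tendsto x atTop (nhds 0) := by
    rw [Metric.tendsto_atTop]
    intro r hr
    obtain ⟨V, hV⟩ := exists_nat_gt (2 / r)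
    have hV0 : (0 : ℝ) < V := (by positivity : 0 < 2 / r).trans hV
    refine ⟨2 ^ (9 * scale V) + 1, fun n hn => ?_⟩
    rw [dist_zero_right]
    by_cases hxn : x n = 0
    · rwa [hxn, norm_zero]
    obtain ⟨p, m, t, hp, hm, ht, rfl⟩ := hx0 n hxn
    obtain ⟨v, hpv, hv, hle⟩ := exists_le_weightExponent_add hp hm ht
    have hVv : V ≤ v := by
      by_contra! hlt
      have := Nat.pow_le_pow_right (show 0 < 2 by norm_num)
        (Nat.mul_le_mul_left 9 (scale_mono hlt.le))
      omega
    have h1 := le_two_div_of_mul_two_pow_le (norm_nonneg (x (m + t)))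
      (by exact_mod_cast hV0) hVv hv (by
        rw [norm_mul_two_pow_eq (hx p m t hp hm ht)]
        exact (hyW p t).trans (by exact_mod_cast hpv))
    refine h1.trans_lt ?_
    rw [div_lt_iff₀ hr] at hV
    rw [div_lt_iff₀ hV0]
    linarith
  set X := nullSequence x hxlim with hX
  have key : ∀ p n, 1 ≤ p → n ∈ times p → ∀ k, ‖(B ^ n) X k - y p k‖ ≤ 2 / p := by
    intro p n hp hn k
    have hiter := shift_pow_apply_mul hB X n k
    rw [hX, nullSequence_apply, mul_comm _ (x _), ← hX] at hiter
    by_cases hk : k ≤ p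
    · rw [hx p n k hp hn hk] at hiter
      rw [mul_right_cancel₀ (pow_ne_zero _ two_ne_zero) hiter, sub_self, norm_zero]
      positivity
    · rw [hy0 p k (by omega), sub_zero]
      by_cases hxn : x (n + k) = 0
      · rw [hxn, zero_mul] at hiter
        rw [(mul_eq_zero.1 hiter).resolve_right (pow_ne_zero _ two_ne_zero), norm_zero]
        positivity
      obtain ⟨q, m, t, hq, hm, ht, hnk⟩ := hx0 _ hxn
      -- A copy placed at or before time `n` ends by `n + p`, which is less than `n + k`.
      have hlt : n < m := by
        by_contra! hle
        rcases hle.eq_or_lt with h | h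
        · subst h
          obtain rfl := times_index_eq hp hq hn hm
          omega
        · have := add_lt_of_times_of_lt hq hp hm hn h
          omega
      obtain ⟨v, hpv, hqv, hv⟩ := exists_le_weightExponent_sub hp hq hn hm hlt ht
      rw [show m - n + t = k by omega] at hv
      rw [hnk, hx q m t hq hm ht] at hiter
      refine le_two_div_of_mul_two_pow_le (norm_nonneg _) hp hpv hv ?_
      rw [norm_mul_two_pow_eq hiter]
      exact (hyW q t).trans (by exact_mod_cast hqv)
  refine ⟨X, fun U hU ⟨z, hz⟩ => ?_⟩
  obtain ⟨r, hr, hball⟩ := Metric.isOpen_iff.1 hU z hz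
  obtain ⟨P, hP⟩ := exists_nat_gt (8 / r)
  obtain ⟨p, hPp, hp⟩ := hyd z (r / 4) (by positivity) (P + 1)
  refine exists_pos_le_lowerLogDensity (p := p) (by omega) fun n hn => ⟨?_, hball ?_⟩
  · obtain ⟨k, -, h, -⟩ := hn
    exact Nat.one_le_two_pow.trans h
  · have hp0 : (P : ℝ) ≤ p := by exact_mod_cast (by omega : P ≤ p)
    have hpos : (0 : ℝ) < p := ((by positivity : 0 < 8 / r).trans hP).trans_le hp0
    have h2 : 2 / (p : ℝ) ≤ r / 4 := by
      rw [div_lt_iff₀ hr] at hP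
      rw [div_le_iff₀ hpos]
      nlinarith
    rw [mem_ball_iff_norm]
    refine (norm_le_of_forall_apply_le (C := r / 2) (by positivity) fun k => ?_).trans_lt
      (by linarith)
    rw [ZeroAtInftyContinuousMap.sub_apply,
      show (B ^ n) X k - z k = ((B ^ n) X k - y p k) + (y p k - z k) by ring]
    refine (norm_add_le _ _).trans ?_
    have := key p n (by omega) hn k
    have := hp k
    linarith

end Hypercyclicity

/-! ### Sparsity of large weight products, and failure of frequent hypercyclicity -/

section Nonhypercyclicity

open Classical in
/-- The points of `[1, N]` near a multiple of the `p`-th period. -/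
noncomputable def nearMultiples (p N : ℕ) : Finset ℕ :=
  (Finset.Icc 1 N).filter fun n =>
    ∃ m, 1 ≤ m ∧ n ≤ m * period p + 3 * p ∧ m * period p ≤ n + 3 * p

theorem card_nearMultiples_mul_le (p N : ℕ) : (nearMultiples p N).card * 2 ^ p ≤ 2 * N := by
  classical
  have hper := lt_period p
  -- If `3 * p ≤ N`, the multiples involved are at most `N + 3 * p ≤ 2 * N`. Otherwise even the
  -- first block lies beyond `N`, because the period exceeds `8 * p`.
  by_cases hN : 3 * p ≤ N
  · have hsub : nearMultiples p N ⊆ (Finset.Icc 1 (2 * N / period p)).biUnion fun m =>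
        Finset.Icc (m * period p - 3 * p) (m * period p + 3 * p) := by
      intro n hn
      obtain ⟨hn, m, hm, h1, h2⟩ := Finset.mem_filter.1 hn
      rw [Finset.mem_Icc] at hn
      refine Finset.mem_biUnion.2 ⟨m, Finset.mem_Icc.2 ⟨hm, ?_⟩, Finset.mem_Icc.2 ⟨by omega, h1⟩⟩
      rw [Nat.le_div_iff_mul_le (period_pos p)]
      omega
    have hcard := (Finset.card_le_card hsub).trans
      (Finset.card_biUnion_le_card_mul _ _ (8 * p + 1) fun m _ => by rw [Nat.card_Icc]; omega)
    rw [Nat.card_Icc, Nat.add_sub_cancel] at hcard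
    calc _ ≤ 2 * N / period p * (8 * p + 1) * 2 ^ p := Nat.mul_le_mul_right _ hcard
      _ = 2 * N / period p * ((8 * p + 1) * 2 ^ p) := mul_assoc _ _ _
      _ ≤ 2 * N / period p * period p := Nat.mul_le_mul_left _ (mul_two_pow_le_period p)
      _ ≤ 2 * N := Nat.div_mul_le_self _ _
  · have : nearMultiples p N = ∅ := by
      refine Finset.filter_eq_empty_iff.2 fun n hn => ?_
      rintro ⟨m, hm, h1, h2⟩
      rw [Finset.mem_Icc] at hn
      have := Nat.mul_le_mul_right (period p) hm
      omega
    rw [this]; simp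

/-- The endpoint `2 ^ (13h)` lies before the next interval, which starts at `2 ^ (16h)`, so all
intervals met end by `2 ^ (12h)`. Height above `s` in a block needs `p > s`, and the block counts
sum geometrically. -/
theorem card_weightExponent_gt_le (s u : ℕ) (hu : 2 ≤ u) :
    (((Finset.Icc 1 (2 ^ (13 * scale u))).filter fun n => s < weightExponent n).card : ℝ) ≤
      2 ^ (12 * scale u) + 2 * 2 ^ (13 * scale u) / 2 ^ s := by
  classical
  set N := 2 ^ (13 * scale u) with hN
  have hsub : ((Finset.Icc 1 N).filter fun n => s < weightExponent n) ⊆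
      Finset.Icc 1 (2 ^ (12 * scale u)) ∪
        (Finset.Ioc s (s + N)).biUnion fun p => nearMultiples p N := by
    intro n hn
    obtain ⟨hn, hs⟩ := Finset.mem_filter.1 hn
    rw [Finset.mem_Icc] at hn
    rcases admissible_weightExponent (n := n) (by omega) with
      ⟨v, hv, -, h1, h2⟩ | ⟨p, m, hp, hm, hk, h1, h2⟩
    · refine Finset.mem_union_left _ (Finset.mem_Icc.2 ⟨hn.1, ?_⟩)
      have hvu : v ≤ u := by
        by_contra! hlt
        have h3 := four_mul_scale_le hu hlt
        have h4 : N ≤ 2 ^ (4 * scale v) := Nat.pow_le_pow_right (by norm_num) (by omega)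
        omega
      have h3 : 2 ^ (12 * scale v) ≤ 2 ^ (12 * scale u) :=
        Nat.pow_le_pow_right (by norm_num) (Nat.mul_le_mul_left _ (scale_mono hvu))
      omega
    · refine Finset.mem_union_right _ (Finset.mem_biUnion.2 ⟨p, Finset.mem_Ioc.2 ⟨by omega, ?_⟩,
        Finset.mem_filter.2 ⟨Finset.mem_Icc.2 hn, m, hm, by omega, by omega⟩⟩)
      have := lt_period p
      have := Nat.mul_le_mul_right (period p) hm
      omega
  have hcard := (Finset.card_le_card hsub).trans ((Finset.card_union_le _ _).trans
    (Nat.add_le_add_left Finset.card_biUnion_le _))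
  rw [Nat.card_Icc, Nat.add_sub_cancel] at hcard
  have hgeom : ∀ M : ℕ, ∑ p ∈ Finset.Ioc s (s + M), ((2 : ℝ) ^ p)⁻¹ ≤
      (2 ^ s)⁻¹ - (2 ^ (s + M))⁻¹ := by
    intro M
    induction M with
    | zero => simp
    | succ M ih =>
      rw [← add_assoc, Finset.sum_Ioc_succ_top (by omega), pow_succ _ (s + M), mul_inv]
      linarith
  have hsum : ∑ p ∈ Finset.Ioc s (s + N), ((nearMultiples p N).card : ℝ) ≤ 2 * N / 2 ^ s := by
    calc _ ≤ ∑ p ∈ Finset.Ioc s (s + N), (2 * N : ℝ) * (2 ^ p)⁻¹ := by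
          refine Finset.sum_le_sum fun p _ => ?_
          rw [← div_eq_mul_inv, le_div_iff₀ (by positivity)]
          exact_mod_cast card_nearMultiples_mul_le p N
      _ = (2 * N : ℝ) * ∑ p ∈ Finset.Ioc s (s + N), ((2 : ℝ) ^ p)⁻¹ := by rw [Finset.mul_sum]
      _ ≤ (2 * N : ℝ) * (2 ^ s)⁻¹ := by
          have : (0 : ℝ) ≤ (2 ^ (s + N))⁻¹ := by positivity
          have := hgeom N
          gcongr
          linarith
      _ = _ := by rw [div_eq_mul_inv]
  have hcard' : (((Finset.Icc 1 N).filter fun n => s < weightExponent n).card : ℝ) ≤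
      2 ^ (12 * scale u) + ∑ p ∈ Finset.Ioc s (s + N), ((nearMultiples p N).card : ℝ) := by
    exact_mod_cast hcard
  have hN' : (N : ℝ) = 2 ^ (13 * scale u) := by rw [hN]; push_cast; rfl
  rw [← hN']
  linarith

/-- A set along which the weight products tend to infinity has zero lower density. -/
theorem lowerNaturalDensity_le_zero {E : Set ℕ}
    (hE : ∀ s, ∃ n₀, ∀ n ∈ E, n₀ ≤ n → s < weightExponent n) : lowerNaturalDensity E ≤ 0 := by
  classical
  by_contra! hpos
  set L := lowerNaturalDensity E
  have hev := eventually_lt_of_lt_lowerWeightedDensity (α := fun _ => 1) (fun _ => zero_le_one)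
    (show L / 2 < _ from half_lt_self hpos)
  obtain ⟨n₁, hn₁⟩ := eventually_atTop.1 hev
  -- With this `s`, the assumed density gives more than `6 * N / s` points of `E` up to `N`, while
  -- the upper bound is `4 * N / s`: `N / s` each from the initial segment and the intervals, `2 * N
  -- / s` from the blocks.
  obtain ⟨s, hs⟩ := exists_nat_gt (12 / L)
  obtain ⟨n₀, hn₀⟩ := hE s
  set u := n₀ + n₁ + s + 2 with hu
  have hus := le_scale u
  set N := 2 ^ (13 * scale u) with hN
  have hNlt : scale u < 2 ^ scale u := Nat.lt_two_pow_self
  have hNmul : N = 2 ^ (12 * scale u) * 2 ^ scale u := by rw [hN, ← pow_add]; congr 1; ring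
  have hN1 : n₁ ≤ N := by
    have : 13 * scale u < N := Nat.lt_two_pow_self
    omega
  have hlt := hn₁ N hN1
  have hcard : ∑ k ∈ Finset.Icc 1 N, E.indicator (fun _ => (1 : ℝ)) k =
      ((Finset.Icc 1 N).filter fun n => n ∈ E).card := by
    simp [Set.indicator_apply]
  have hNpos : (0 : ℝ) < N := by rw [hN]; positivity
  rw [hcard, Finset.sum_const, Nat.card_Icc, Nat.add_sub_cancel, nsmul_eq_mul, mul_one,
    lt_div_iff₀ hNpos] at hlt
  have hsub : ((Finset.Icc 1 N).filter fun n => n ∈ E) ⊆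
      Finset.Icc 1 n₀ ∪ (Finset.Icc 1 N).filter fun n => s < weightExponent n := by
    intro n hn
    obtain ⟨h1, h2⟩ := Finset.mem_filter.1 hn
    by_cases h : n₀ ≤ n
    · exact Finset.mem_union_right _ (Finset.mem_filter.2 ⟨h1, hn₀ n h2 h⟩)
    · rw [Finset.mem_Icc] at h1
      exact Finset.mem_union_left _ (Finset.mem_Icc.2 ⟨h1.1, by omega⟩)
  have hle := (Finset.card_le_card hsub).trans (Finset.card_union_le _ _)
  rw [Nat.card_Icc, Nat.add_sub_cancel] at hle
  have hle' : (((Finset.Icc 1 N).filter fun n => n ∈ E).card : ℝ) ≤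
      n₀ + ((Finset.Icc 1 N).filter fun n => s < weightExponent n).card := by exact_mod_cast hle
  have hbound := card_weightExponent_gt_le s u (by omega)
  have hNR : (N : ℝ) = 2 ^ (13 * scale u) := by rw [hN]; push_cast; rfl
  rw [← hN, ← hNR] at hbound
  have hspos : (0 : ℝ) < s := (by positivity : 0 < 12 / L).trans hs
  have h2s : (s : ℝ) ≤ 2 ^ s := by exact_mod_cast (Nat.lt_two_pow_self (n := s)).le
  have hn0 : (n₀ : ℝ) ≤ 2 ^ (12 * scale u) := by
    have : 12 * scale u < 2 ^ (12 * scale u) := Nat.lt_two_pow_self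
    exact_mod_cast (by omega : n₀ ≤ 2 ^ (12 * scale u))
  have h12 : (2 : ℝ) ^ (12 * scale u) * s ≤ N := by
    rw [hNmul]
    exact_mod_cast Nat.mul_le_mul_left _ (by omega : s ≤ 2 ^ scale u)
  have hdiv : 2 * (N : ℝ) / 2 ^ s * s ≤ 2 * N := by
    rw [div_mul_eq_mul_div, div_le_iff₀ (by positivity)]
    gcongr
  rw [div_lt_iff₀ hpos] at hs
  have hA : L / 2 * N < n₀ + (2 ^ (12 * scale u) + 2 * (N : ℝ) / 2 ^ s) := by linarith
  have hB : L / 2 * N * s < (n₀ + (2 ^ (12 * scale u) + 2 * (N : ℝ) / 2 ^ s)) * s :=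
    mul_lt_mul_of_pos_right hA hspos
  have hC : (n₀ : ℝ) * s ≤ 2 ^ (12 * scale u) * s := by gcongr
  have hD : 12 * (N : ℝ) < s * L * N := by gcongr
  nlinarith

variable {𝕜 : Type*} [RCLike 𝕜]

theorem not_frequentlyHypercyclic_of_weight {B : C₀(ℕ, 𝕜) →L[𝕜] C₀(ℕ, 𝕜)}
    (hB : IsWeightedBackwardShift weight B) : ¬ FrequentlyHypercyclic B := by
  rintro ⟨x, hx⟩
  have hcont : Continuous fun y : C₀(ℕ, 𝕜) => ‖y 0‖ :=
    (AddMonoidHomClass.continuous_of_bound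
      (⟨⟨fun y : C₀(ℕ, 𝕜) => y 0, rfl⟩, fun _ _ => rfl⟩ : C₀(ℕ, 𝕜) →+ 𝕜) 1 fun y => by
        rw [one_mul]; exact norm_apply_le y 0).norm
  have hne : ({y : C₀(ℕ, 𝕜) | 1 < ‖y 0‖}).Nonempty :=
    ⟨nullSequence (fun n => if n = 0 then 2 else 0)
      (tendsto_const_nhds.congr' (by
        filter_upwards [eventually_gt_atTop 0] with n hn
        rw [if_neg hn.ne'])), by simp⟩
  -- The coordinate 0 of `B ^ n x` is the weight product times `x n`; where it exceeds 1 in norm,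
  -- `‖x n‖ < 2 ^ (-s)` forces the exponent above `s`.
  refine (hx _ (isOpen_lt continuous_const hcont) hne).not_ge
    (lowerNaturalDensity_le_zero fun s => ?_)
  obtain ⟨n₀, hn₀⟩ := eventually_atTop.1 (Metric.tendsto_nhds.1 (tendsto_nullSequence x)
    ((2 ^ s)⁻¹ : ℝ) (by positivity))
  refine ⟨n₀, fun n ⟨_, hn⟩ hle => ?_⟩
  have h := congrArg norm (shift_pow_apply_mul hB x n 0)
  simp only [weightExponent_zero, pow_zero, mul_one, add_zero, norm_mul, norm_pow,
    RCLike.norm_ofNat] at h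
  have h1 : ‖x n‖ < (2 ^ s)⁻¹ := by simpa using hn₀ n hle
  have h2 : (1 : ℝ) < 2 ^ weightExponent n * ‖x n‖ := by rw [← h]; exact hn
  by_contra! hlt
  have h3 : (2 : ℝ) ^ weightExponent n ≤ 2 ^ s := pow_le_pow_right₀ (by norm_num) hlt
  have h4 : (2 : ℝ) ^ weightExponent n * ‖x n‖ ≤ 2 ^ s * (2 ^ s)⁻¹ := by gcongr
  rw [mul_inv_cancel₀ (by positivity)] at h4
  linarith

end Nonhypercyclicity

theorem mainTheorem4 (𝕜 : Type*) [RCLike 𝕜] :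
    ∃ (a ε : ℝ) (b : ℕ → ℕ) (w : ℕ → ℝ) (B : C₀(ℕ, 𝕜) →L[𝕜] C₀(ℕ, 𝕜)),
      1 < a ∧ 0 < ε ∧ 1 + 4 * ε < a ^ 2 * (1 - 4 * ε) ∧
      StrictMono b ∧ (∀ p : ℕ, 1 ≤ p → (8 * p + 1) * 2 ^ p ≤ b p) ∧
      (∀ n : ℕ, 1 ≤ n → 1 / 2 ≤ w n ∧ w n ≤ 2) ∧
      IsBuiltFromLacunaryIntervals a ε b w ∧
      IsWeightedBackwardShift w B ∧
      (∃ S : C₀(ℕ, 𝕜) →L[𝕜] C₀(ℕ, 𝕜), B ∘L S = ContinuousLinearMap.id 𝕜 C₀(ℕ, 𝕜)) ∧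
      LogFrequentlyHypercyclic B ∧ ¬ FrequentlyHypercyclic B := by
  obtain ⟨B, hB, hS⟩ := exists_isWeightedBackwardShift (𝕜 := 𝕜) (w := weight) weight_bounds
  exact ⟨2, 1 / 8, period, weight, B, by norm_num, by norm_num, by norm_num, period_strictMono,
    fun p _ => mul_two_pow_le_period p, fun n _ => weight_bounds n,
    isBuiltFromLacunaryIntervals_weight, hB, hS, logFrequentlyHypercyclic_of_weight hB,
    not_frequentlyHypercyclic_of_weight hB⟩
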